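/- **Lemma 5.1 (Equi-coerciveness of $E_\varepsilon^\omega$).** Let $p\in[0,1]$, let $(\Sigma,\mathcal F,\mathbf P)$ be a probability space, and let $(\xi_b)_b$ be independent identically distributed random variables on it, indexed by the nearest-neighbour bonds $b=\{i,j\}$ ($i,j\in\mathbb Z^2$, $|i-j|=1$) of $\mathbb Z^2$, with $\mathbf P(\xi_b=1)=p$ and $\mathbf P(\xi_b=0)=1-p$. For $\omega\in\Sigma$ put $\sigma^\omega_{ij}=+\infty$ if $\xi_{\{i,j\}}(\omega)=1$ and $\sigma^\omega_{ij}=1$ otherwise. Let $\Omega\subset\mathbb R^2$ be a bounded open set with Lipschitz boundary. For $\varepsilon>0$ let $\Omega_\varepsilon=\frac1\varepsilon\Omega\cap\mathbb Z^2$ and, for $u:\Omega_\varepsilon\to\{\pm1\}$, $$E^\omega_\varepsilon(u)=\frac18\sum_{i,j\in\Omega_\varepsilon,\ |i-j|=1}\varepsilon\,\sigma^\omega_{ij}\,(u_i-u_j)^2\in[0,+\infty]$$ (the sum is over ordered pairs, and $\infty\cdot0=0$). Identify $u$ with the function on $\Omega$ equal to $u_i$ on each square $\varepsilon i+\varepsilon[-\frac12,\frac12)^2$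 contained in $\Omega$, and equal to $1$ elsewhere in $\Omega$. Then there is a set $\widetilde\Sigma\subseteq\Sigma$ with $\mathbf P(\widetilde\Sigma)=1$ such that, for every $\omega\in\widetilde\Sigma$, the following holds: if $(\varepsilon_k)$ is a sequence of positive numbers converging to $0$ and $u_{\varepsilon_k}:\Omega_{\varepsilon_k}\to\{\pm1\}$ satisfy $\sup_kE^\omega_{\varepsilon_k}(u_{\varepsilon_k})<+\infty$, then there exist $u\in BV(\Omega;\{\pm1\})$ and a subsequence of $(u_{\varepsilon_k})$ that converges to $u$ in $L^1(\Omega)$. Here $BV(\Omega;\{\pm1\})$ is the set of functions in $L^1(\Omega)$ with values in $\{\pm1\}$ whose distributional first derivatives are Radon measures with finite total variation in $\Omega$. -/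

import Mathlib

open Set Filter Topology MeasureTheory ProbabilityTheory
open scoped ENNReal NNReal

noncomputable section

namespace RigidSpin

/-- The Euclidean plane `ℝ²`. -/
abbrev Plane : Type := EuclideanSpace ℝ (Fin 2)

/-- The integer lattice `ℤ²`. -/
abbrev Site : Type := Fin 2 → ℤ

/-- A lattice point seen as a point of the plane. -/
def Site.toPlane (i : Site) : Plane := WithLp.toLp 2 fun a => (i a : ℝ)

/-! ### Bond percolation on the square lattice -/

/-- The nearest-neighbour graph of `ℤ²`: `i` and `j` are adjacent when `|i - j| = 1`. -/
def squareLattice : SimpleGraph Site where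
  Adj i j := dist i.toPlane j.toPlane = 1
  symm := ⟨fun i j h => by rw [dist_comm]; exact h⟩
  loopless := ⟨fun i h => by simp at h⟩

/-- The (unoriented) bonds of `ℤ²`. -/
abbrev Bond : Type := squareLattice.edgeSet

/-- `ξ` is an i.i.d. family of random variables indexed by the bonds of `ℤ²`, with the value
`1` (strong bond) with probability `p` and `0` (weak bond) with probability `1 - p`. -/
structure IsBondPercolation {S : Type*} [MeasurableSpace S] (P : Measure S)
    (ξ : Bond → S → ℝ) (p : ℝ) : Prop where
  measurable : ∀ b, Measurable (ξ b)
  indep : iIndepFun ξ P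
  strong : ∀ b, P {ω | ξ b ω = 1} = ENNReal.ofReal p
  weak : ∀ b, P {ω | ξ b ω = 0} = ENNReal.ofReal (1 - p)

open Classical in
/-- The coefficient of the bond `b`: `+∞` if the bond is strong, `1` otherwise. -/
def coeff {S : Type*} (ξ : Bond → S → ℝ) (ω : S) (b : Bond) : ℝ≥0∞ :=
  if ξ b ω = 1 then ∞ else 1

/-! ### Discrete spin functions and their energies -/

/-- `Ω_ε = (1/ε) Ω ∩ ℤ²`. -/
def scaledSites (Ω : Set Plane) (ε : ℝ) : Set Site := {i | ε • i.toPlane ∈ Ω}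

/-- Spin functions `Ω_ε → {±1}`; the type `ℤˣ` has exactly the two elements `1` and `-1`. -/
abbrev SpinFun (Ω : Set Plane) (ε : ℝ) : Type := scaledSites Ω ε → ℤˣ

/-- The value `±1` of a spin as a real number. -/
def spinVal (s : ℤˣ) : ℝ := ((s : ℤ) : ℝ)

open Classical in
/-- The rigid spin energy `(1/8) ∑ ε σ_ij (u_i - u_j)²`. The sum is over the ordered pairs of
nearest neighbours in `Ω_ε`, so that each bond is counted twice. In `ℝ≥0∞` one has `∞ * 0 = 0`. -/
def energy {S : Type*} (ξ : Bond → S → ℝ) (ω : S) (Ω : Set Plane) (ε : ℝ)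
    (u : SpinFun Ω ε) : ℝ≥0∞ :=
  (1 / 8) * ∑' (i : scaledSites Ω ε) (j : scaledSites Ω ε),
    if h : squareLattice.Adj i j then
      ENNReal.ofReal ε * coeff ξ ω ⟨s((i : Site), (j : Site)), h⟩ *
        ENNReal.ofReal ((spinVal (u i) - spinVal (u j)) ^ 2)
    else 0

/-- The half-open coordinate square `ε i + ε [-1/2, 1/2)²`. -/
def cell (ε : ℝ) (i : Site) : Set Plane :=
  {x | ∀ a, ε * (i a : ℝ) - ε / 2 ≤ x a ∧ x a < ε * (i a : ℝ) + ε / 2}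

/-- The index of the square `cell ε i` that contains `x` (see `mem_cell_iff`). -/
def cellIndex (ε : ℝ) (x : Plane) : Site := fun a => ⌊x a / ε + 1 / 2⌋

theorem mem_cell_iff {ε : ℝ} (hε : 0 < ε) (i : Site) (x : Plane) :
    x ∈ cell ε i ↔ cellIndex ε x = i := by
  simp only [cell, cellIndex, mem_ofPred_eq, funext_iff, Int.floor_eq_iff]
  refine forall_congr' fun a => and_congr ?_ ?_
  · rw [← sub_le_iff_le_add, le_div_iff₀ hε]
    constructor <;> intro h <;> linarith
  · rw [← lt_sub_iff_add_lt, div_lt_iff₀ hε]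
    constructor <;> intro h <;> linarith

open Classical in
/-- The piecewise-constant extension of a spin function: the value `u_i` on each square
`cell ε i` contained in `Ω`, and `1` elsewhere. -/
def extension {Ω : Set Plane} {ε : ℝ} (u : SpinFun Ω ε) (x : Plane) : ℝ :=
  if h : cellIndex ε x ∈ scaledSites Ω ε ∧ cell ε (cellIndex ε x) ⊆ Ω then
    spinVal (u ⟨cellIndex ε x, h.1⟩)
  else 1

/-- For `ε > 0`, a square contained in `Ω` has its centre in `Ω`. -/
theorem mem_scaledSites_of_cell_subset {Ω : Set Plane} {ε : ℝ} (hε : 0 < ε) {i : Site}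
    (hi : cell ε i ⊆ Ω) : i ∈ scaledSites Ω ε :=
  hi fun a => by
    simp only [Site.toPlane, PiLp.smul_apply, smul_eq_mul]
    constructor <;> linarith

theorem extension_of_mem_cell {Ω : Set Plane} {ε : ℝ} (hε : 0 < ε) (u : SpinFun Ω ε) {i : Site}
    (hi : cell ε i ⊆ Ω) {x : Plane} (hx : x ∈ cell ε i) :
    extension u x = spinVal (u ⟨i, mem_scaledSites_of_cell_subset hε hi⟩) := by
  obtain rfl := (mem_cell_iff hε i x).1 hx
  rw [extension, dif_pos ⟨mem_scaledSites_of_cell_subset hε hi, hi⟩]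

theorem extension_of_forall_notMem {Ω : Set Plane} {ε : ℝ} (hε : 0 < ε) (u : SpinFun Ω ε)
    {x : Plane} (hx : ∀ i, cell ε i ⊆ Ω → x ∉ cell ε i) : extension u x = 1 :=
  dif_neg fun h => hx _ h.2 ((mem_cell_iff hε _ x).2 rfl)

/-! ### Lipschitz open sets and functions of bounded variation -/

/-- `Ω` is an open set with Lipschitz boundary: near each boundary point, in suitable Cartesian
coordinates, it is the set of points strictly above the graph of a Lipschitz function. -/
def IsLipschitzOpen (Ω : Set Plane) : Prop :=
  IsOpen Ω ∧ ∀ x ∈ frontier Ω, ∃ (A : Plane ≃ᵃⁱ[ℝ] Plane) (g : ℝ → ℝ) (K : ℝ≥0),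
    LipschitzWith K g ∧ ∀ᶠ y in 𝓝 x, y ∈ Ω ↔ g (A y 0) < A y 1

/-- The signed measure `D` represents on `Ω` the distributional derivative of `u` in the `a`-th
coordinate direction: `∫_Ω u ∂_a φ dx = - ∫ φ dD` for all `φ ∈ C_c^∞(Ω)`. -/
def IsDistribDeriv (Ω : Set Plane) (u : Plane → ℝ) (a : Fin 2) (D : SignedMeasure Plane) : Prop :=
  ∀ φ : Plane → ℝ, ContDiff ℝ (⊤ : ℕ∞) φ → HasCompactSupport φ → tsupport φ ⊆ Ω →
    ∫ x in Ω, u x * fderiv ℝ φ x (EuclideanSpace.single a 1) = -∫ᵛ x, φ x ∂•D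

/-- `u ∈ BV(Ω)`: `u` is integrable on `Ω` and its distributional first derivatives are measures
with finite total variation. (A signed measure has finite total variation; its restriction to
`Ω` is a finite signed Radon measure on `Ω`.) -/
def MemBV (Ω : Set Plane) (u : Plane → ℝ) : Prop :=
  IntegrableOn u Ω volume ∧ ∀ a : Fin 2, ∃ D : SignedMeasure Plane, IsDistribDeriv Ω u a D

/-- `u ∈ BV(Ω; {±1})`. -/
def MemBVSpin (Ω : Set Plane) (u : Plane → ℝ) : Prop :=
  MemBV Ω u ∧ ∀ x ∈ Ω, u x = 1 ∨ u x = -1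

end RigidSpin

end

/-!
The coefficients of the energy are all at least `1`, whatever the configuration `ω`. Hence a bound
on the energy is a bound on the perimeter of the interface between the two phases, and the
conclusion holds for every `ω`: it is the compactness of sets of bounded perimeter. The argument is
local, and uses only that `Ω` is open and bounded.

The perimeter bound enters as an `L¹` bound for translations (`HasTranslationBound`). When the
segment from `x` to `x + h e_a` stays well inside `Ω`, the extension `f` of a spin function changes
along it by at most the sum of the jumps across the sides of squares that the segment crosses. A
given side of length `ε` is crossed for a set of `x` of measure `ε h`, so the integral of
`|f (x + h e_a) - f x|` over the points far enough from the complement of `Ω` is at most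
`h ∑ ε |u_i - u_j| ≤ 4 h E_ε(u)` (`hasTranslationBound_extension`).

Compactness in `L¹(Ω)` follows as in the Kolmogorov–Riesz theorem
(`exists_subseq_tendsto_eLpNorm`). A subsequence converges weakly in `L²`, so its averages over
small cubes converge pointwise and, by dominated convergence, in `L¹`. The translation bound makes
these averages uniformly close to the functions themselves away from the boundary of `Ω`, and the
boundary layer has small measure. The limit takes the values `±1` almost everywhere.

The limit inherits the translation bound, and this gives bounded variation
(`MemBV.of_hasTranslationBound`): the difference quotients of the limit are the densities of
signed measures of bounded mass supported in the compact set `closure Ω`. The positive and the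
negative parts have weak limits along an ultrafilter, by Prokhorov's theorem, and integration by
parts for difference quotients identifies the difference of these limits as the distributional
derivative.
-/

noncomputable section

namespace RigidSpin

/-! ### Inner parts of a set and boxes in the plane -/

/-- The open set of the points at distance more than `r` from the complement of `Ω`. -/
def inset (Ω : Set Plane) (r : ℝ) : Set Plane := (Metric.cthickening r Ωᶜ)ᶜ

theorem measurableSet_inset (Ω : Set Plane) (r : ℝ) : MeasurableSet (inset Ω r) :=
  Metric.isClosed_cthickening.measurableSet.compl

theorem inset_subset (Ω : Set Plane) (r : ℝ) : inset Ω r ⊆ Ω := fun _ hx => by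
  by_contra h
  exact hx (Metric.self_subset_cthickening _ h)

theorem inset_anti (Ω : Set Plane) {r s : ℝ} (h : r ≤ s) : inset Ω s ⊆ inset Ω r :=
  compl_subset_compl.2 (Metric.cthickening_mono h _)

theorem mem_inset_of_dist_le {Ω : Set Plane} {r s : ℝ} {x y : Plane} (hs : 0 ≤ s) (hsr : s ≤ r)
    (hx : x ∈ inset Ω r) (hxy : dist x y ≤ s) : y ∈ inset Ω (r - s) := by
  intro hy
  refine hx ?_
  have h := Metric.cthickening_cthickening_subset hs (sub_nonneg.2 hsr) Ωᶜ
  rw [add_sub_cancel] at h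
  exact h (Metric.mem_cthickening_of_dist_le x y s _ hy hxy)

theorem mem_of_mem_inset_of_dist_le {Ω : Set Plane} {r : ℝ} {x y : Plane}
    (hx : x ∈ inset Ω r) (hxy : dist x y ≤ r) : y ∈ Ω :=
  inset_subset _ _ (mem_inset_of_dist_le (dist_nonneg.trans hxy) le_rfl hx hxy)

theorem exists_subset_inset {Ω K : Set Plane} (hΩ : IsOpen Ω) (hK : IsCompact K) (hKΩ : K ⊆ Ω) :
    ∃ r > 0, K ⊆ inset Ω r := by
  obtain ⟨δ, hδ, h⟩ := hK.exists_cthickening_subset_open hΩ hKΩ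
  refine ⟨δ / 2, half_pos hδ, fun x hx hx' => ?_⟩
  obtain ⟨y, hy, hxy⟩ := (Metric.mem_thickening_iff.1
    (Metric.cthickening_subset_thickening' hδ (half_lt_self hδ) _ hx'))
  exact hy (h (Metric.mem_cthickening_of_dist_le y x δ _ hx (by rw [dist_comm]; exact hxy.le)))

theorem tendsto_volume_diff_inset {Ω : Set Plane} (hΩ : IsOpen Ω) (hΩb : Bornology.IsBounded Ω) :
    Tendsto (fun r => volume (Ω \ inset Ω r)) (𝓝 0) (𝓝 0) := by
  have : IsFiniteMeasure (volume.restrict Ω) := ⟨by simpa using hΩb.measure_lt_top⟩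
  have h := tendsto_measure_cthickening_of_isClosed (μ := volume.restrict Ω) (s := Ωᶜ)
    ⟨1, one_pos, measure_ne_top _ _⟩ hΩ.isClosed_compl
  rw [Measure.restrict_apply hΩ.measurableSet.compl, compl_inter_self, measure_empty] at h
  refine h.congr fun r => ?_
  rw [Measure.restrict_apply Metric.isClosed_cthickening.measurableSet, inset, sdiff_compl,
    inter_comm]

theorem measurableSet_box (l u : Fin 2 → ℝ) :
    MeasurableSet {x : Plane | ∀ a, l a ≤ x a ∧ x a < u a} := by
  simp only [ofPred_forall]
  refine MeasurableSet.iInter fun a => ?_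
  exact (measurableSet_Ico (a := l a) (b := u a)).preimage
    (by fun_prop : Measurable fun x : Plane => x a)

theorem volume_box (l u : Fin 2 → ℝ) :
    volume {x : Plane | ∀ a, l a ≤ x a ∧ x a < u a} = ∏ a, ENNReal.ofReal (u a - l a) := by
  rw [← Real.volume_pi_Ico, ← (PiLp.volume_preserving_ofLp (Fin 2)).measure_preimage
    (MeasurableSet.univ_pi fun _ => measurableSet_Ico).nullMeasurableSet]
  congr 1
  ext x
  simp

/-! ### Translation estimates -/

/-- The unit vector in the `a`-th coordinate direction. -/
abbrev unitVec (a : Fin 2) : Plane := EuclideanSpace.single a 1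

theorem norm_smul_unitVec {h : ℝ} (hh : 0 ≤ h) (a : Fin 2) : ‖h • unitVec a‖ = h := by
  simp [norm_smul, abs_of_nonneg hh]

theorem dist_add_smul_unitVec {h : ℝ} (hh : 0 ≤ h) (a : Fin 2) (x : Plane) :
    dist x (x + h • unitVec a) = h := by
  rw [dist_self_add_right, norm_smul_unitVec hh]

/-- An `L¹` Lipschitz bound, with constant `C`, for the translations of `f` in the coordinate
directions by at most `r / 2`, on the points of `Ω` at distance more than `r` from `Ωᶜ`. -/
def HasTranslationBound (Ω : Set Plane) (C : ℝ≥0∞) (f : Plane → ℝ) (r : ℝ) : Prop :=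
  ∀ (a : Fin 2) (h : ℝ), 0 ≤ h → 2 * h ≤ r →
    ∫⁻ x in inset Ω r, ‖f (x + h • unitVec a) - f x‖ₑ ≤ C * ENNReal.ofReal h

/-- Translating the domain of integration: the translate of `A` by `y` lies in `B`. -/
theorem setLIntegral_add_right_le {A B : Set Plane} (hA : MeasurableSet A) (hB : MeasurableSet B)
    {y : Plane} (h : ∀ x ∈ A, x + y ∈ B) (g : Plane → ℝ≥0∞) :
    ∫⁻ x in A, g (x + y) ≤ ∫⁻ x in B, g x := by
  rw [← lintegral_indicator hA, ← lintegral_indicator hB,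
    ← lintegral_add_right_eq_self (B.indicator g) y]
  refine lintegral_mono fun x => ?_
  by_cases hx : x ∈ A
  · simp [hx, h x hx]
  · simp [hx]

/-- Translations by vectors of `[0, δ)²` are done one coordinate at a time; the margin `3 * δ` keeps
the intermediate point in `inset Ω (2 * δ)`. -/
theorem HasTranslationBound.lintegral_add_le {Ω : Set Plane} {C : ℝ≥0∞} {f : Plane → ℝ}
    {δ : ℝ} (hf : HasTranslationBound Ω C f (2 * δ)) (hfm : Measurable f) (hδ : 0 ≤ δ)
    {s : Plane} (hs : ∀ a, 0 ≤ s a ∧ s a < δ) :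
    ∫⁻ x in inset Ω (3 * δ), ‖f x - f (x + s)‖ₑ ≤ C * ENNReal.ofReal (2 * δ) := by
  have key : ∀ x, ‖f x - f (x + s)‖ₑ ≤ ‖f (x + s 0 • unitVec 0) - f x‖ₑ +
      ‖f (x + s 0 • unitVec 0 + s 1 • unitVec 1) - f (x + s 0 • unitVec 0)‖ₑ := fun x => by
    have e : x + s = x + s 0 • unitVec 0 + s 1 • unitVec 1 := by
      ext a; fin_cases a <;> simp
    rw [e, ← edist_eq_enorm_sub, ← edist_eq_enorm_sub, ← edist_eq_enorm_sub,
      edist_comm _ (f x), edist_comm (f (x + _ + _))]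
    exact edist_triangle _ _ _
  calc ∫⁻ x in inset Ω (3 * δ), ‖f x - f (x + s)‖ₑ
      ≤ ∫⁻ x in inset Ω (3 * δ), (‖f (x + s 0 • unitVec 0) - f x‖ₑ +
        ‖f (x + s 0 • unitVec 0 + s 1 • unitVec 1) - f (x + s 0 • unitVec 0)‖ₑ) :=
        lintegral_mono key
    _ = (∫⁻ x in inset Ω (3 * δ), ‖f (x + s 0 • unitVec 0) - f x‖ₑ) +
        ∫⁻ x in inset Ω (3 * δ), ‖f (x + s 0 • unitVec 0 + s 1 • unitVec 1) -
          f (x + s 0 • unitVec 0)‖ₑ := lintegral_add_left (by fun_prop) _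
    _ ≤ (∫⁻ x in inset Ω (2 * δ), ‖f (x + s 0 • unitVec 0) - f x‖ₑ) +
        ∫⁻ x in inset Ω (2 * δ), ‖f (x + s 1 • unitVec 1) - f x‖ₑ := by
        refine add_le_add (lintegral_mono_set (inset_anti _ (by linarith))) ?_
        refine setLIntegral_add_right_le (measurableSet_inset _ _) (measurableSet_inset _ _)
          (fun x hx => ?_) fun x => ‖f (x + s 1 • unitVec 1) - f x‖ₑ
        have := mem_inset_of_dist_le hδ (by linarith) hx
          ((dist_add_smul_unitVec (hs 0).1 0 x).le.trans (hs 0).2.le)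
        exact inset_anti _ (by linarith) this
    _ ≤ C * ENNReal.ofReal δ + C * ENNReal.ofReal δ := by
        gcongr
        · exact (hf 0 _ (hs 0).1 (by linarith [(hs 0).2])).trans (by gcongr; exact (hs 0).2.le)
        · exact (hf 1 _ (hs 1).1 (by linarith [(hs 1).2])).trans (by gcongr; exact (hs 1).2.le)
    _ = C * ENNReal.ofReal (2 * δ) := by
        rw [← mul_add, ← ENNReal.ofReal_add hδ hδ, two_mul]

/-- The half-open cube `[0, δ)²`. -/
def cube (δ : ℝ) : Set Plane := {x | ∀ a, 0 ≤ x a ∧ x a < δ}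

theorem measurableSet_cube (δ : ℝ) : MeasurableSet (cube δ) :=
  measurableSet_box (fun _ => 0) fun _ => δ

theorem volume_cube (δ : ℝ) : volume (cube δ) = ENNReal.ofReal δ ^ 2 := by
  have := volume_box (fun _ => 0) fun _ => δ
  rw [show cube δ = {x : Plane | ∀ a, 0 ≤ x a ∧ x a < δ} from rfl, this]
  simp

theorem norm_le_of_mem_cube {δ : ℝ} {s : Plane} (hs : s ∈ cube δ) : ‖s‖ ≤ 2 * δ := by
  have h0 := hs 0
  have h1 := hs 1
  rw [EuclideanSpace.norm_eq, Fin.sum_univ_two, Real.norm_eq_abs, Real.norm_eq_abs, sq_abs, sq_abs]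
  refine Real.sqrt_le_iff.2 ⟨by linarith, ?_⟩
  nlinarith

theorem isProbabilityMeasure_cond_cube {δ : ℝ} (hδ : 0 < δ) :
    IsProbabilityMeasure (volume[|cube δ]) := by
  refine cond_isProbabilityMeasure_of_finite ?_ ?_ <;> rw [volume_cube] <;> simp [hδ]

/-- A translation bound controls the `L¹` distance of `f` to its average over the cubes
`x + [0, δ)²`. -/
theorem HasTranslationBound.lintegral_sub_average_le {Ω : Set Plane} {C : ℝ≥0∞} {f : Plane → ℝ}
    {δ : ℝ} (hf : HasTranslationBound Ω C f (2 * δ)) (hfm : Measurable f) (hf1 : ∀ x, |f x| ≤ 1)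
    (hδ : 0 < δ) :
    ∫⁻ x in inset Ω (3 * δ), ‖f x - ∫ s, f (x + s) ∂volume[|cube δ]‖ₑ ≤
      C * ENNReal.ofReal (2 * δ) := by
  have := isProbabilityMeasure_cond_cube hδ
  have hint : ∀ x, Integrable (fun s => f (x + s)) volume[|cube δ] := fun x =>
    Integrable.of_bound (hfm.comp (measurable_const_add x)).aestronglyMeasurable 1 (.of_forall fun s => hf1 _)
  calc ∫⁻ x in inset Ω (3 * δ), ‖f x - ∫ s, f (x + s) ∂volume[|cube δ]‖ₑ
      ≤ ∫⁻ x in inset Ω (3 * δ), ∫⁻ s, ‖f x - f (x + s)‖ₑ ∂volume[|cube δ] := by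
        refine lintegral_mono fun x => ?_
        have e : f x - ∫ s, f (x + s) ∂volume[|cube δ] =
            ∫ s, (f x - f (x + s)) ∂volume[|cube δ] := by
          rw [integral_sub (integrable_const _) (hint x)]; simp
        simp only [e]
        exact enorm_integral_le_lintegral_enorm _
    _ = ∫⁻ s, (∫⁻ x in inset Ω (3 * δ), ‖f x - f (x + s)‖ₑ) ∂volume[|cube δ] :=
        lintegral_lintegral_swap (Measurable.aemeasurable (by unfold Function.uncurry; fun_prop))
    _ ≤ ∫⁻ s, C * ENNReal.ofReal (2 * δ) ∂volume[|cube δ] := by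
        refine lintegral_mono_ae ?_
        filter_upwards [ae_cond_mem (measurableSet_cube δ)] with s hs
        exact hf.lintegral_add_le hfm hδ.le hs
    _ = C * ENNReal.ofReal (2 * δ) := by simp

/-! ### Compactness in `L¹` -/

/-- Uniformly bounded functions on a finite measure space have a subsequence whose integrals over
every measurable set converge: this is weak sequential compactness in `L²`. -/
theorem exists_subseq_tendsto_setIntegral (μ : Measure Plane) [IsFiniteMeasure μ]
    {f : ℕ → Plane → ℝ} (hfm : ∀ k, Measurable (f k)) (hf1 : ∀ k x, |f k x| ≤ 1) :
    ∃ n : ℕ → ℕ, StrictMono n ∧ ∀ A, MeasurableSet A →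
      ∃ l, Tendsto (fun m => ∫ x in A, f (n m) x ∂μ) atTop (𝓝 l) := by
  have hmem : ∀ k, MemLp (f k) 2 μ := fun k =>
    MemLp.of_bound (hfm k).aestronglyMeasurable 1 (.of_forall (hf1 k))
  let F : ℕ → Lp ℝ 2 μ := fun k => (hmem k).toLp (f k)
  let φ : ℕ → WeakDual ℝ (Lp ℝ 2 μ) := fun k => StrongDual.toWeakDual (innerSL ℝ (F k))
  obtain ⟨R, hR⟩ : ∃ R : ℝ, ∀ k, ‖F k‖ ≤ R :=
    ⟨_, fun k => Lp.norm_le_of_ae_bound (C := 1) zero_le_one (by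
      filter_upwards [(hmem k).coeFn_toLp] with x hx
      rw [hx]; exact hf1 k x)⟩
  have : Fact ((2 : ℝ≥0∞) ≠ ∞) := ⟨by simp⟩
  obtain ⟨ψ, -, n, hn, hψ⟩ := WeakDual.isSeqCompact_closedBall ℝ (Lp ℝ 2 μ) 0 R (x := φ)
    (fun k => by
      rw [mem_preimage, mem_closedBall_zero_iff]
      exact (innerSL_apply_norm ℝ (F k)).trans_le (hR k))
  refine ⟨n, hn, fun A hA => ⟨ψ (indicatorConstLp 2 hA (measure_ne_top μ A) 1), ?_⟩⟩
  have h := ((WeakDual.eval_continuous (𝕜 := ℝ)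
    (indicatorConstLp 2 hA (measure_ne_top μ A) (1 : ℝ))).tendsto ψ).comp hψ
  refine h.congr fun m => ?_
  have : φ (n m) (indicatorConstLp 2 hA (measure_ne_top μ A) (1 : ℝ)) =
      ∫ x in A, F (n m) x ∂μ := by
    rw [← L2.inner_indicatorConstLp_one (𝕜 := ℝ) hA (measure_ne_top μ A), real_inner_comm]
    rfl
  simp only [Function.comp_apply, this]
  exact integral_congr_ae (ae_restrict_of_ae (hmem _).coeFn_toLp)

theorem integral_cond_cube_eq (f : Plane → ℝ) (δ : ℝ) (x : Plane) :
    ∫ s, f (x + s) ∂volume[|cube δ] =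
      (volume (cube δ))⁻¹.toReal • ∫ y in (fun y => -x + y) ⁻¹' cube δ, f y := by
  rw [ProbabilityTheory.cond, integral_smul_measure]
  congr 1
  rw [← (measurePreserving_add_left volume (-x)).setIntegral_preimage_emb
    (measurableEmbedding_addLeft (-x))]
  simp

/-- If the integrals of `f k` over all measurable subsets of `Ω` converge, then so do, in `L¹`,
their averages over small cubes. -/
theorem tendsto_lintegral_average {Ω : Set Plane} (hΩb : Bornology.IsBounded Ω)
    {f : ℕ → Plane → ℝ} (hfm : ∀ k, Measurable (f k)) (hf1 : ∀ k x, |f k x| ≤ 1)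
    (hw : ∀ A, MeasurableSet A →
      ∃ l, Tendsto (fun k => ∫ x in A, f k x ∂volume.restrict Ω) atTop (𝓝 l))
    {δ : ℝ} (hδ : 0 < δ) :
    ∃ g : Plane → ℝ, Measurable g ∧ Tendsto (fun k => ∫⁻ x in inset Ω (3 * δ),
      ‖(∫ s, f k (x + s) ∂volume[|cube δ]) - g x‖ₑ) atTop (𝓝 0) := by
  have := isProbabilityMeasure_cond_cube hδ
  have hΩfin : volume (inset Ω (3 * δ)) < ∞ :=
    (measure_mono (inset_subset _ _)).trans_lt hΩb.measure_lt_top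
  let G : ℕ → Plane → ℝ := fun k x => ∫ s, f k (x + s) ∂volume[|cube δ]
  have hGm : ∀ k, Measurable (G k) := fun k => by
    refine (StronglyMeasurable.integral_prod_right (f := fun x s => f k (x + s)) ?_).measurable
    exact Measurable.stronglyMeasurable (by unfold Function.uncurry; fun_prop)
  have hG1 : ∀ k x, |G k x| ≤ 1 := fun k x => by
    have := norm_integral_le_of_norm_le_const (μ := volume[|cube δ]) (f := fun s => f k (x + s))
      (.of_forall fun s => hf1 k (x + s))
    simpa using this
  have hlim : ∀ x ∈ inset Ω (3 * δ), ∃ l, Tendsto (fun k => G k x) atTop (𝓝 l) := by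
    intro x hx
    obtain ⟨l, hl⟩ := hw _ ((measurable_const_add (-x)) (measurableSet_cube δ))
    refine ⟨_, (hl.const_smul (volume (cube δ))⁻¹.toReal).congr fun k => ?_⟩
    simp only [G, integral_cond_cube_eq]
    congr 2
    rw [Measure.restrict_restrict ((measurable_const_add (-x)) (measurableSet_cube δ))]
    congr 1
    refine inter_eq_left.2 fun y hy => mem_of_mem_inset_of_dist_le hx ?_
    have := norm_le_of_mem_cube (δ := δ) (s := -x + y) hy
    rw [dist_eq_norm', sub_eq_neg_add]
    linarith
  let g : Plane → ℝ := fun x => limsup (fun k => G k x) atTop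
  have hg : ∀ x ∈ inset Ω (3 * δ), Tendsto (fun k => G k x) atTop (𝓝 (g x)) := fun x hx => by
    obtain ⟨l, hl⟩ := hlim x hx
    rwa [show g x = l from hl.limsup_eq]
  have hgm : Measurable g := Measurable.limsup hGm
  refine ⟨g, hgm, ?_⟩
  have h0 : (0 : ℝ≥0∞) = ∫⁻ x in inset Ω (3 * δ), 0 := by simp
  rw [h0]
  refine tendsto_lintegral_of_dominated_convergence (fun _ => 2)
    (fun k => ((hGm k).sub hgm).enorm) (fun k => ?_) ?_ ?_
  · filter_upwards [ae_restrict_mem (measurableSet_inset _ _)] with x hx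
    have hgx : |g x| ≤ 1 := le_of_tendsto (hg x hx).abs (.of_forall fun k => hG1 k x)
    calc ‖G k x - g x‖ₑ ≤ ‖(2 : ℝ)‖ₑ := by
          rw [enorm_le_iff_norm_le, Real.norm_eq_abs, Real.norm_eq_abs]
          exact (abs_sub _ _).trans (by rw [abs_two]; linarith [hG1 k x])
      _ = 2 := by simp [Real.enorm_eq_ofReal]
  · simp [hΩfin.ne, ENNReal.mul_eq_top]
  · filter_upwards [ae_restrict_mem (measurableSet_inset _ _)] with x hx
    have := ((hg x hx).sub_const (g x)).enorm
    simpa using this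

/-- A form of the Kolmogorov–Riesz theorem on a bounded open set `Ω`: a uniformly bounded sequence
with a uniform translation bound on each inner part of `Ω` is relatively compact in `L¹(Ω)`. -/
theorem exists_subseq_tendsto_eLpNorm {Ω : Set Plane} (hΩ : IsOpen Ω)
    (hΩb : Bornology.IsBounded Ω) {C : ℝ≥0∞} (hC : C ≠ ∞)
    {f : ℕ → Plane → ℝ} (hfm : ∀ k, Measurable (f k)) (hf1 : ∀ k x, |f k x| ≤ 1)
    (hf : ∀ r > 0, ∀ᶠ k in atTop, HasTranslationBound Ω C (f k) r) :
    ∃ v : Plane → ℝ, Measurable v ∧ ∃ n : ℕ → ℕ, StrictMono n ∧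
      Tendsto (fun m => eLpNorm (f (n m) - v) 1 (volume.restrict Ω)) atTop (𝓝 0) := by
  have : IsFiniteMeasure (volume.restrict Ω) := ⟨by simpa using hΩb.measure_lt_top⟩
  obtain ⟨n, hn, hw⟩ := exists_subseq_tendsto_setIntegral (volume.restrict Ω) hfm hf1
  have hmem : ∀ k, MemLp (f k) 1 (volume.restrict Ω) := fun k =>
    MemLp.of_bound (hfm k).aestronglyMeasurable 1 (.of_forall (hf1 k))
  have hcauchy : CauchySeq fun m => (hmem (n m)).toLp (f (n m)) := by
    rw [EMetric.cauchySeq_iff]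
    intro η' hη'
    obtain ⟨η, hη, hηη'⟩ := exists_between hη'
    have hη8 : 0 < η / 8 := ENNReal.div_pos hη.ne' (by simp)
    -- `δ` makes both the boundary layer and the error of averaging small.
    obtain ⟨δ, ⟨hδ1, hδ2⟩, hδ⟩ : ∃ δ : ℝ, (volume (Ω \ inset Ω (3 * δ)) < η / 8 ∧
        C * ENNReal.ofReal (2 * δ) < η / 8) ∧ 0 < δ := by
      have h1 : Tendsto (fun δ : ℝ => volume (Ω \ inset Ω (3 * δ))) (𝓝[>] 0) (𝓝 0) :=
        (tendsto_volume_diff_inset hΩ hΩb).comp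
          ((by fun_prop : Continuous fun δ : ℝ => 3 * δ).tendsto' 0 0 (by simp)
            |>.mono_left nhdsWithin_le_nhds)
      have h2 : Tendsto (fun δ : ℝ => C * ENNReal.ofReal (2 * δ)) (𝓝[>] 0) (𝓝 0) := by
        refine Tendsto.mono_left ?_ nhdsWithin_le_nhds
        have := ENNReal.Tendsto.const_mul (a := C)
          ((ENNReal.continuous_ofReal.comp (continuous_const_mul (2 : ℝ))).tendsto 0) (.inr hC)
        simpa using this
      exact ((h1.eventually_lt_const hη8).and (h2.eventually_lt_const hη8)
        |>.and self_mem_nhdsWithin).exists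
    obtain ⟨g, hgm, hg⟩ := tendsto_lintegral_average hΩb (fun m => hfm (n m))
      (fun m => hf1 (n m)) hw hδ
    have hev := (hg.eventually_lt_const hη8).and
      (hn.tendsto_atTop.eventually (hf (2 * δ) (by positivity)))
    have hclose : ∀ᶠ m in atTop,
        ∫⁻ x in inset Ω (3 * δ), ‖f (n m) x - g x‖ₑ ≤ η / 8 + η / 8 := by
      filter_upwards [hev] with m hm
      have hGm : Measurable fun x => ∫ s, f (n m) (x + s) ∂volume[|cube δ] := by
        refine (StronglyMeasurable.integral_prod_right
          (f := fun x s => f (n m) (x + s)) ?_).measurable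
        have := hfm (n m)
        exact Measurable.stronglyMeasurable (by unfold Function.uncurry; fun_prop)
      have hfm' := hfm (n m)
      calc ∫⁻ x in inset Ω (3 * δ), ‖f (n m) x - g x‖ₑ
          ≤ ∫⁻ x in inset Ω (3 * δ),
            (‖f (n m) x - ∫ s, f (n m) (x + s) ∂volume[|cube δ]‖ₑ +
              ‖(∫ s, f (n m) (x + s) ∂volume[|cube δ]) - g x‖ₑ) := by
            refine lintegral_mono fun x => ?_
            simp only [← edist_eq_enorm_sub]
            exact edist_triangle _ _ _
        _ = _ := lintegral_add_left (hfm'.sub hGm).enorm _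
        _ ≤ η / 8 + η / 8 :=
            add_le_add ((hm.2.lintegral_sub_average_le hfm' (hf1 _) hδ).trans hδ2.le) hm.1.le
    obtain ⟨N, hN⟩ := eventually_atTop.1 hclose
    refine ⟨N, fun m hm k hk => ?_⟩
    have hsum : η / 8 + η / 8 + (η / 8 + η / 8) + 2 * (η / 8) < η' := by
      refine lt_of_le_of_lt ?_ hηη'
      calc η / 8 + η / 8 + (η / 8 + η / 8) + 2 * (η / 8) = 6 * (η / 8) := by ring
        _ ≤ 8 * (η / 8) := by gcongr; norm_num
        _ = η := ENNReal.mul_div_cancel (by simp) (by simp)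
    rw [Lp.edist_toLp_toLp, eLpNorm_one_eq_lintegral_enorm]
    refine lt_of_le_of_lt ?_ hsum
    have hfm1 := hfm (n m)
    have hfm2 := hfm (n k)
    calc ∫⁻ x in Ω, ‖(f (n m) - f (n k)) x‖ₑ
        ≤ (∫⁻ x in inset Ω (3 * δ), ‖(f (n m) - f (n k)) x‖ₑ) +
          ∫⁻ x in Ω \ inset Ω (3 * δ), ‖(f (n m) - f (n k)) x‖ₑ := by
          refine (lintegral_mono_set ?_).trans (lintegral_union_le _ _ _)
          rw [union_sdiff_self]
          exact subset_union_right
      _ ≤ (∫⁻ x in inset Ω (3 * δ), (‖f (n m) x - g x‖ₑ + ‖f (n k) x - g x‖ₑ)) +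
          ∫⁻ x in Ω \ inset Ω (3 * δ), 2 := by
          refine add_le_add (lintegral_mono fun x => ?_) (lintegral_mono fun x => ?_)
          · simp only [Pi.sub_apply, ← edist_eq_enorm_sub]
            exact edist_triangle_right _ _ _
          · calc ‖(f (n m) - f (n k)) x‖ₑ ≤ ‖(2 : ℝ)‖ₑ := by
                  rw [enorm_le_iff_norm_le, Real.norm_eq_abs, Real.norm_eq_abs]
                  exact (abs_sub _ _).trans
                    (by rw [abs_two]; linarith [hf1 (n m) x, hf1 (n k) x])
              _ = 2 := by simp [Real.enorm_eq_ofReal]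
      _ ≤ η / 8 + η / 8 + (η / 8 + η / 8) + 2 * (η / 8) := by
          rw [lintegral_add_left (by fun_prop), setLIntegral_const]
          gcongr
          · exact hN m hm
          · exact hN k hk
  obtain ⟨V, hV⟩ := cauchySeq_tendsto_of_complete hcauchy
  refine ⟨_, (Lp.stronglyMeasurable V).measurable, n, hn, ?_⟩
  rw [Lp.tendsto_Lp_iff_tendsto_eLpNorm'] at hV
  refine hV.congr fun m => eLpNorm_congr_ae ?_
  filter_upwards [(hmem (n m)).coeFn_toLp] with x hx
  simp [hx]

/-- Translation bounds pass to the limit in `L¹(Ω)`. -/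
theorem HasTranslationBound.of_tendsto {Ω : Set Plane} (hΩ : IsOpen Ω) {C : ℝ≥0∞} {r : ℝ}
    {f : ℕ → Plane → ℝ} {v : Plane → ℝ} (hfm : ∀ k, Measurable (f k)) (hvm : Measurable v)
    (hf : ∀ᶠ k in atTop, HasTranslationBound Ω C (f k) r)
    (hlim : Tendsto (fun k => eLpNorm (f k - v) 1 (volume.restrict Ω)) atTop (𝓝 0)) :
    HasTranslationBound Ω C v r := by
  intro a h hh hr
  have hlim' : Tendsto (fun k => eLpNorm (f k - v) 1 (volume.restrict Ω) + C * ENNReal.ofReal h +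
      eLpNorm (f k - v) 1 (volume.restrict Ω)) atTop (𝓝 (C * ENNReal.ofReal h)) := by
    simpa using (hlim.add_const (C * ENNReal.ofReal h)).add hlim
  refine ge_of_tendsto hlim' ?_
  filter_upwards [hf] with k hk
  have hfm' := hfm k
  calc ∫⁻ x in inset Ω r, ‖v (x + h • unitVec a) - v x‖ₑ
      ≤ ∫⁻ x in inset Ω r, (‖(f k - v) (x + h • unitVec a)‖ₑ +
        ‖f k (x + h • unitVec a) - f k x‖ₑ + ‖(f k - v) x‖ₑ) := by
        refine lintegral_mono fun x => ?_
        simp only [Pi.sub_apply, ← edist_eq_enorm_sub]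
        rw [edist_comm (f k (x + _)) (v _)]
        exact edist_triangle4 _ _ _ _
    _ = (∫⁻ x in inset Ω r, ‖(f k - v) (x + h • unitVec a)‖ₑ) +
        (∫⁻ x in inset Ω r, ‖f k (x + h • unitVec a) - f k x‖ₑ) +
        ∫⁻ x in inset Ω r, ‖(f k - v) x‖ₑ := by
        rw [lintegral_add_left (by fun_prop), lintegral_add_left (by fun_prop)]
    _ ≤ _ := by
        rw [eLpNorm_one_eq_lintegral_enorm]
        refine add_le_add (add_le_add ?_ (hk a h hh hr)) (lintegral_mono_set (inset_subset _ _))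
        refine setLIntegral_add_right_le (measurableSet_inset _ _) hΩ.measurableSet
          (fun x hx => mem_of_mem_inset_of_dist_le hx ?_) fun x => ‖(f k - v) x‖ₑ
        rw [dist_add_smul_unitVec hh]
        linarith

/-! ### From translation bounds to bounded variation -/

theorem integral_withDensity_sub {μ : Measure Plane} {q φ : Plane → ℝ}
    (hq : Measurable q) {M : ℝ} (hqM : ∀ x, |q x| ≤ M) (hφ : Integrable φ μ) :
    ∫ x, φ x ∂μ.withDensity (fun x => ENNReal.ofReal (q x)) -
      ∫ x, φ x ∂μ.withDensity (fun x => ENNReal.ofReal (-q x)) = ∫ x, q x * φ x ∂μ := by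
  rw [integral_withDensity_eq_integral_toReal_smul (by fun_prop) (by simp),
    integral_withDensity_eq_integral_toReal_smul (by fun_prop) (by simp), ← integral_sub]
  · refine integral_congr_ae (.of_forall fun x => ?_)
    simp only [ENNReal.toReal_ofReal', smul_eq_mul, ← sub_mul]
    rw [max_zero_sub_max_neg_zero_eq_self]
  · refine hφ.bdd_mul (c := M) (Measurable.aestronglyMeasurable (by fun_prop)) (.of_forall fun x => ?_)
    rw [ENNReal.toReal_ofReal', Real.norm_eq_abs, abs_of_nonneg (le_max_right _ _)]
    exact max_le ((le_abs_self _).trans (hqM x)) ((abs_nonneg _).trans (hqM x))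
  · refine hφ.bdd_mul (c := M) (Measurable.aestronglyMeasurable (by fun_prop)) (.of_forall fun x => ?_)
    rw [ENNReal.toReal_ofReal', Real.norm_eq_abs, abs_of_nonneg (le_max_right _ _)]
    exact max_le ((neg_le_abs _).trans (hqM x)) ((abs_nonneg _).trans (hqM x))

/-- Discrete integration by parts. -/
theorem integral_translate_sub_mul {v φ : Plane → ℝ} (hv : Measurable v) (hv1 : ∀ x, |v x| ≤ 1)
    (hφ : Integrable φ) (y : Plane) :
    ∫ x, (v (x + y) - v x) * φ x = ∫ x, v x * (φ (x - y) - φ x) := by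
  have h1 : Integrable fun x => v x * φ x :=
    hφ.bdd_mul (c := 1) hv.aestronglyMeasurable (.of_forall hv1)
  have h2 : Integrable fun x => v (x + y) * φ x :=
    hφ.bdd_mul (c := 1) (Measurable.aestronglyMeasurable (by fun_prop)) (.of_forall fun x => hv1 _)
  have h3 : Integrable fun x => v x * φ (x - y) :=
    (hφ.comp_sub_right y).bdd_mul (c := 1) hv.aestronglyMeasurable (.of_forall hv1)
  simp only [sub_mul, mul_sub]
  rw [integral_sub h2 h1, integral_sub h3 h1,
    ← integral_add_right_eq_self (fun x => v x * φ (x - y)) y]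
  simp

/-- Integrals against difference quotients of a test function converge to the integral against its
partial derivative. -/
theorem tendsto_integral_diffQuot {v φ : Plane → ℝ} (hv : Measurable v) (hv1 : ∀ x, |v x| ≤ 1)
    (hφ : ContDiff ℝ (⊤ : ℕ∞) φ) (hφc : HasCompactSupport φ) (a : Fin 2)
    {h : ℕ → ℝ} (hh : ∀ n, 0 < h n) (hh1 : ∀ n, h n ≤ 1) (hlim : Tendsto h atTop (𝓝 0)) :
    Tendsto (fun n => ∫ x, v x * ((φ (x - h n • unitVec a) - φ x) / h n)) atTop
      (𝓝 (-∫ x, v x * fderiv ℝ φ x (unitVec a))) := by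
  obtain ⟨L, hL⟩ := hφ.lipschitzWith_of_hasCompactSupport hφc (by simp)
  obtain ⟨R, hR⟩ := hφc.isCompact.isBounded.subset_closedBall (0 : Plane)
  have hcont := hφ.continuous
  rw [← integral_neg]
  refine tendsto_integral_of_dominated_convergence
    ((Metric.closedBall (0 : Plane) (R + 1)).indicator fun _ => (L : ℝ))
    (fun n => Measurable.aestronglyMeasurable (by fun_prop)) ?_ (fun n => .of_forall fun x => ?_)
    (.of_forall fun x => ?_)
  · rw [integrable_indicator_iff measurableSet_closedBall]
    exact integrableOn_const measure_closedBall_lt_top.ne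
  · have hvan : ∀ y, y ∉ Metric.closedBall (0 : Plane) R → φ y = 0 := fun y hy =>
      image_eq_zero_of_notMem_tsupport fun h => hy (hR h)
    by_cases hx : x ∈ Metric.closedBall (0 : Plane) (R + 1)
    · rw [indicator_of_mem hx, norm_mul, norm_div, Real.norm_of_nonneg (hh n).le]
      have h1 : ‖φ (x - h n • unitVec a) - φ x‖ ≤ L * h n := by
        have := hL.dist_le_mul (x - h n • unitVec a) x
        rwa [dist_eq_norm, dist_eq_norm, sub_sub_cancel_left, norm_neg,
          norm_smul_unitVec (hh n).le] at this
      calc ‖v x‖ * (‖φ (x - h n • unitVec a) - φ x‖ / h n) ≤ 1 * L := by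
            gcongr
            · exact div_nonneg (norm_nonneg _) (hh n).le
            · exact hv1 x
            · exact (div_le_iff₀ (hh n)).2 h1
        _ = L := one_mul _
    · rw [indicator_of_notMem hx, hvan x, hvan (x - h n • unitVec a)]
      · simp
      · rw [mem_closedBall_zero_iff] at hx ⊢
        have := norm_sub_norm_le x (h n • unitVec a)
        rw [norm_smul_unitVec (hh n).le] at this
        linarith [hh1 n]
      · rw [mem_closedBall_zero_iff] at hx ⊢
        linarith
  · have hd : HasFDerivAt φ (fderiv ℝ φ x) x := (hφ.differentiable (by simp) x).hasFDerivAt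
    have h1 := (hd.hasLineDerivAt (unitVec a)).tendsto_slope_zero
    have h2 : Tendsto (fun n => -h n) atTop (𝓝[≠] 0) :=
      tendsto_nhdsWithin_iff.2 ⟨by simpa using hlim.neg, .of_forall fun n => by simp [(hh n).ne']⟩
    have h3 := ((h1.comp h2).neg.const_mul (v x))
    rw [mul_neg] at h3
    refine h3.congr fun n => ?_
    simp only [Function.comp_apply, smul_eq_mul, neg_smul, ← sub_eq_add_neg, inv_neg, neg_mul,
      neg_neg, div_eq_inv_mul]

/-- A bounded function satisfying a translation bound, uniformly on the inner parts of `Ω`, has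
bounded variation in `Ω`. The positive and negative parts of its difference quotients are measures
of bounded mass, and the derivative is the difference of two weak limits of these. -/
theorem MemBV.of_hasTranslationBound {Ω : Set Plane} (hΩ : IsOpen Ω)
    (hΩb : Bornology.IsBounded Ω) {C : ℝ≥0∞} (hC : C ≠ ∞) {v : Plane → ℝ} (hv : Measurable v)
    (hv1 : ∀ x, |v x| ≤ 1) (hvC : ∀ r > 0, HasTranslationBound Ω C v r) : MemBV Ω v := by
  refine ⟨IntegrableOn.of_bound hΩb.measure_lt_top hv.aestronglyMeasurable 1 (.of_forall hv1),
    fun a => ?_⟩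
  let h : ℕ → ℝ := fun n => 1 / ((n : ℝ) + 1)
  have hh : ∀ n, 0 < h n := fun n => Nat.one_div_pos_of_nat
  have hh1 : ∀ n, h n ≤ 1 := fun n => by
    simpa [h] using Nat.one_div_le_one_div (α := ℝ) (Nat.zero_le n)
  have hlim : Tendsto h atTop (𝓝 0) := tendsto_one_div_add_atTop_nhds_zero_nat
  let q : ℕ → Plane → ℝ := fun n x => (v (x + h n • unitVec a) - v x) / h n
  have hqm : ∀ n, Measurable (q n) := fun n => by fun_prop
  have hqM : ∀ n x, |q n x| ≤ 2 / h n := fun n x => by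
    rw [abs_div, abs_of_pos (hh n)]
    gcongr
    exact (abs_sub _ _).trans (by linarith [hv1 (x + h n • unitVec a), hv1 x])
  -- `2 * h n` is the smallest margin for which the translation bound allows the step `h n`.
  let B : ℕ → Measure Plane := fun n => volume.restrict (inset Ω (2 * h n))
  have hmass : ∀ n (g : Plane → ℝ), (∀ x, g x ≤ |q n x|) →
      (B n).withDensity (fun x => ENNReal.ofReal (g x)) univ ≤ C := fun n g hg => by
    rw [withDensity_apply _ .univ, Measure.restrict_univ]
    calc ∫⁻ x, ENNReal.ofReal (g x) ∂B n
        ≤ ∫⁻ x, ‖v (x + h n • unitVec a) - v x‖ₑ * ENNReal.ofReal (h n)⁻¹ ∂B n := by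
          refine lintegral_mono fun x => ?_
          rw [Real.enorm_eq_ofReal_abs, ← ENNReal.ofReal_mul (abs_nonneg _)]
          refine ENNReal.ofReal_le_ofReal ((hg x).trans_eq ?_)
          rw [abs_div, abs_of_pos (hh n), div_eq_mul_inv]
      _ = (∫⁻ x, ‖v (x + h n • unitVec a) - v x‖ₑ ∂B n) * ENNReal.ofReal (h n)⁻¹ :=
          lintegral_mul_const _ (by fun_prop)
      _ ≤ C * ENNReal.ofReal (h n) * ENNReal.ofReal (h n)⁻¹ := by
          gcongr
          exact hvC _ (mul_pos two_pos (hh n)) a (h n) (hh n).le le_rfl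
      _ = C := by
          rw [mul_assoc, ← ENNReal.ofReal_mul (hh n).le, mul_inv_cancel₀ (hh n).ne',
            ENNReal.ofReal_one, mul_one]
  have hsupp : ∀ n (g : Plane → ℝ),
      (B n).withDensity (fun x => ENNReal.ofReal (g x)) (closure Ω)ᶜ = 0 := fun n g => by
    refine withDensity_absolutelyContinuous _ _ ?_
    rw [Measure.restrict_apply isClosed_closure.measurableSet.compl]
    refine measure_mono_null (fun x hx => hx.1 ?_) measure_empty
    exact subset_closure (inset_subset _ _ hx.2)
  have hweak : ∀ g : ℕ → Plane → ℝ, (∀ n x, g n x ≤ |q n x|) →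
      ∃ μ : Measure Plane, IsFiniteMeasure μ ∧ ∀ φ : BoundedContinuousFunction Plane ℝ,
        Tendsto (fun n => ∫ x, φ x ∂(B n).withDensity (fun x => ENNReal.ofReal (g n x)))
          (hyperfilter ℕ) (𝓝 (∫ x, φ x ∂μ)) := fun g hg => by
    let m : ℕ → FiniteMeasure Plane := fun n =>
      ⟨(B n).withDensity (fun x => ENNReal.ofReal (g n x)),
        ⟨(hmass n (g n) (hg n)).trans_lt hC.lt_top⟩⟩
    have hcomp := isCompact_setOfPred_finiteMeasure_le_of_isCompact C.toNNReal
      hΩb.isCompact_closure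
    obtain ⟨μ, -, hμ⟩ := hcomp.ultrafilter_le_nhds' ((hyperfilter ℕ).map m)
      (Ultrafilter.mem_map.2 <| univ_mem' fun n => ⟨ENNReal.toNNReal_mono hC (hmass n (g n) (hg n)), by
        rw [FiniteMeasure.null_iff_toMeasure_null]
        exact hsupp n (g n)⟩)
    exact ⟨μ, inferInstance, FiniteMeasure.tendsto_iff_forall_integral_tendsto.1 hμ⟩
  obtain ⟨μp, hμp, hp⟩ := hweak q fun n x => le_abs_self _
  obtain ⟨μm, hμm, hm⟩ := hweak (fun n x => -q n x) fun n x => neg_le_abs _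
  refine ⟨μp.toSignedMeasure - μm.toSignedMeasure, fun φ hφ hφc hφΩ => ?_⟩
  obtain ⟨M, hM⟩ := hφ.continuous.bounded_above_of_compact_support hφc
  let φb : BoundedContinuousFunction Plane ℝ :=
    BoundedContinuousFunction.ofNormedAddCommGroup φ hφ.continuous M hM
  have hφi : Integrable φ := hφ.continuous.integrable_of_hasCompactSupport hφc
  have hD : ∫ᵛ x, φ x ∂•(μp.toSignedMeasure - μm.toSignedMeasure) =
      ∫ x, φ x ∂μp - ∫ x, φ x ∂μm := by
    have hint : ∀ μ : Measure Plane, IsFiniteMeasure μ → Integrable φ μ := fun μ _ =>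
      hφ.continuous.integrable_of_hasCompactSupport hφc
    have hflip : ContinuousLinearMap.lsmul ℝ ℝ (E := ℝ) =
        (ContinuousLinearMap.lsmul ℝ ℝ (E := ℝ)).flip := by
      ext; simp
    rw [VectorMeasure.integral_sub_vectorMeasure, hflip, VectorMeasure.integral_toSignedMeasure,
      VectorMeasure.integral_toSignedMeasure]
    · rw [VectorMeasure.Integrable, Measure.variation_toSignedMeasure]
      exact hint μp hμp
    · rw [VectorMeasure.Integrable, Measure.variation_toSignedMeasure]
      exact hint μm hμm
  rw [hD]
  obtain ⟨r, hr, hφr⟩ := exists_subset_inset hΩ hφc.isCompact hφΩ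
  have hev : ∀ᶠ n in atTop, 2 * h n < r := by
    have : Tendsto (fun n => 2 * h n) atTop (𝓝 0) := by simpa using hlim.const_mul 2
    exact this.eventually_lt_const hr
  have hlim1 : Tendsto (fun n => ∫ x, v x * ((φ (x - h n • unitVec a) - φ x) / h n))
      (hyperfilter ℕ) (𝓝 (∫ x, φ x ∂μp - ∫ x, φ x ∂μm)) := by
    refine Tendsto.congr' ?_ ((hp φb).sub (hm φb))
    filter_upwards [Nat.hyperfilter_le_atTop hev] with n hn
    change ∫ x, φ x ∂_ - ∫ x, φ x ∂_ = _
    rw [integral_withDensity_sub (hqm n) (hqM n) hφi.integrableOn]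
    rw [setIntegral_eq_integral_of_forall_compl_eq_zero fun x hx => ?_]
    · have := congrArg (· / h n) (integral_translate_sub_mul hv hv1 hφi (h n • unitVec a))
      simp only [← integral_div] at this
      simpa only [q, div_mul_eq_mul_div, mul_div_assoc] using this
    · rw [image_eq_zero_of_notMem_tsupport fun h' => hx (inset_anti _ hn.le (hφr h')), mul_zero]
  have hlim2 := (tendsto_integral_diffQuot hv hv1 hφ hφc a hh hh1 hlim).mono_left
    Nat.hyperfilter_le_atTop
  have heq := tendsto_nhds_unique hlim1 hlim2
  rw [heq, neg_neg]
  refine setIntegral_eq_integral_of_forall_compl_eq_zero fun x hx => ?_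
  rw [image_eq_zero_of_notMem_tsupport (f := fderiv ℝ φ)
    fun h' => hx (hφΩ (tsupport_fderiv_subset ℝ h'))]
  simp

/-! ### Piecewise-constant extensions of spin functions -/

theorem spinVal_eq_or (s : ℤˣ) : spinVal s = 1 ∨ spinVal s = -1 := by
  rcases Int.units_eq_one_or s with rfl | rfl <;> simp [spinVal]

theorem extension_eq_or {Ω : Set Plane} {ε : ℝ} (u : SpinFun Ω ε) (x : Plane) :
    extension u x = 1 ∨ extension u x = -1 := by
  rw [extension]
  split_ifs
  · exact spinVal_eq_or _
  · exact .inl rfl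

theorem measurable_cellIndex (ε : ℝ) : Measurable (cellIndex ε) :=
  measurable_pi_lambda _ fun a => Int.measurable_floor.comp (by fun_prop)

open Classical in
theorem measurable_extension {Ω : Set Plane} {ε : ℝ} (u : SpinFun Ω ε) :
    Measurable (extension u) := by
  let F : Site → ℝ := fun i =>
    if h : i ∈ scaledSites Ω ε ∧ cell ε i ⊆ Ω then spinVal (u ⟨i, h.1⟩) else 1
  exact (Measurable.of_discrete (f := F)).comp (measurable_cellIndex ε)

/-! ### The energy controls translations -/

theorem dist_le_sum_abs (x y : Plane) : dist x y ≤ ∑ a, |x a - y a| := by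
  rw [EuclideanSpace.dist_eq, Fin.sum_univ_two, Fin.sum_univ_two, Real.dist_eq, Real.dist_eq]
  refine Real.sqrt_le_iff.2 ⟨by positivity, ?_⟩
  nlinarith [abs_nonneg (x 0 - y 0), abs_nonneg (x 1 - y 1)]

theorem toPlane_add_single (i : Site) (a : Fin 2) :
    (i + Pi.single a 1 : Site).toPlane = i.toPlane + unitVec a := by
  ext b
  by_cases hb : b = a
  · subst hb; simp [Site.toPlane]
  · simp [Site.toPlane, hb]

theorem adj_add_single (i : Site) (a : Fin 2) : squareLattice.Adj i (i + Pi.single a 1) := by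
  change dist i.toPlane (i + Pi.single a 1 : Site).toPlane = 1
  rw [toPlane_add_single, dist_self_add_right]
  simp

theorem one_le_coeff {S : Type*} (ξ : Bond → S → ℝ) (ω : S) (b : Bond) : 1 ≤ coeff ξ ω b := by
  rw [coeff]
  split_ifs <;> simp

/-- For spins, a jump is half of its square. -/
theorem enorm_spinVal_sub (s t : ℤˣ) :
    ‖spinVal s - spinVal t‖ₑ = 1 / 2 * ENNReal.ofReal ((spinVal t - spinVal s) ^ 2) := by
  have h2 : (1 / 2 : ℝ≥0∞) = ENNReal.ofReal (1 / 2) := by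
    rw [ENNReal.ofReal_div_of_pos two_pos]; simp
  rw [Real.enorm_eq_ofReal_abs, h2, ← ENNReal.ofReal_mul (by norm_num)]
  congr 1
  rcases spinVal_eq_or s with h | h <;> rcases spinVal_eq_or t with h' | h' <;>
    rw [h, h'] <;> norm_num

open Classical in
/-- The size of the jump of `u` across the bond from `i` to `i + e_a`, and `0` if this bond does
not have both endpoints in `Ω_ε`. -/
def jump {Ω : Set Plane} {ε : ℝ} (u : SpinFun Ω ε) (a : Fin 2) (i : Site) : ℝ≥0∞ :=
  if h : i ∈ scaledSites Ω ε ∧ i + Pi.single a 1 ∈ scaledSites Ω ε then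
    ‖spinVal (u ⟨_, h.2⟩) - spinVal (u ⟨_, h.1⟩)‖ₑ
  else 0

/-- Every coefficient is at least `1`, so the energy controls the perimeter of the interface. -/
theorem tsum_jump_le_energy {S : Type*} (ξ : Bond → S → ℝ) (ω : S) {Ω : Set Plane} {ε : ℝ}
    (u : SpinFun Ω ε) (a : Fin 2) :
    (∑' i, jump u a i) * ENNReal.ofReal ε ≤ 4 * energy ξ ω Ω ε u := by
  have hsub : ∑' i, jump u a i = ∑' i : scaledSites Ω ε, jump u a i := by
    rw [tsum_subtype (scaledSites Ω ε) (jump u a)]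
    refine tsum_congr fun i => ?_
    by_cases hi : i ∈ scaledSites Ω ε
    · rw [indicator_of_mem hi]
    · rw [indicator_of_notMem hi, jump, dif_neg fun h => hi h.1]
  have h48 : (4 : ℝ≥0∞) * (1 / 8) = 1 / 2 := by
    rw [show (8 : ℝ≥0∞) = 4 * 2 by norm_num, one_div, one_div,
      ENNReal.mul_inv (by simp) (by simp), ← mul_assoc, ENNReal.mul_inv_cancel (by simp) (by simp),
      one_mul]
  rw [hsub, energy, ← mul_assoc, h48, ← ENNReal.tsum_mul_left, ← ENNReal.tsum_mul_right]
  refine ENNReal.tsum_le_tsum fun i => ?_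
  by_cases hj : (i : Site) + Pi.single a 1 ∈ scaledSites Ω ε
  · refine le_trans ?_ (mul_le_mul_right (ENNReal.le_tsum
      (⟨(i : Site) + Pi.single a 1, hj⟩ : scaledSites Ω ε)) _)
    rw [dif_pos (adj_add_single i a), jump, dif_pos ⟨i.2, hj⟩, enorm_spinVal_sub, mul_assoc,
      mul_comm _ (ENNReal.ofReal ε)]
    gcongr
    exact le_mul_of_one_le_right (zero_le) (one_le_coeff _ _ _)
  · rw [jump, dif_neg fun h => hj h.2, zero_mul]
    exact zero_le

/-- The points `x` such that the segment from `x` to `x + h e_a` crosses the side between the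
squares of indices `i` and `i + e_a`. -/
def crossing (ε h : ℝ) (a : Fin 2) (i : Site) : Set Plane :=
  {x | ∀ b, Function.update (fun b => ε * (i b : ℝ) - ε / 2) a (ε * (i a : ℝ) + ε / 2 - h) b ≤ x b ∧
    x b < ε * (i b : ℝ) + ε / 2}

theorem measurableSet_crossing (ε h : ℝ) (a : Fin 2) (i : Site) :
    MeasurableSet (crossing ε h a i) := measurableSet_box _ _

theorem volume_crossing (ε h : ℝ) (a : Fin 2) (i : Site) :
    volume (crossing ε h a i) = ENNReal.ofReal ε * ENNReal.ofReal h := by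
  rw [crossing, volume_box, Fin.prod_univ_two]
  fin_cases a
  · simp [mul_comm]
  · simp

theorem cell_subset_of_mem_inset {Ω : Set Plane} {ε r : ℝ} (hε : 0 < ε) (hr : 2 * ε ≤ r)
    {x : Plane} (hx : x ∈ inset Ω r) : cell ε (cellIndex ε x) ⊆ Ω := by
  intro z hz
  refine mem_of_mem_inset_of_dist_le hx ((dist_le_sum_abs x z).trans ?_)
  have hx' := (mem_cell_iff hε _ x).2 rfl
  have h : ∀ b, |x b - z b| ≤ ε := fun b =>
    abs_le.2 ⟨by linarith [(hx' b).1, (hz b).2], by linarith [(hx' b).2, (hz b).1]⟩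
  rw [Fin.sum_univ_two]
  linarith [h 0, h 1]

/-- The jump of the extension between `x` and `x + h e_a` is at most the sum of the jumps across
the sides crossed by the segment joining them. -/
theorem enorm_extension_sub_le {Ω : Set Plane} {ε r h : ℝ} (hε : 0 < ε) (hr : 4 * ε ≤ r)
    (hh : 0 ≤ h) (hhr : 2 * h ≤ r) (u : SpinFun Ω ε) (a : Fin 2) {x : Plane}
    (hx : x ∈ inset Ω r) :
    ‖extension u (x + h • unitVec a) - extension u x‖ₑ ≤
      ∑' i, (crossing ε h a i).indicator (fun _ => jump u a i) x := by
  classical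
  set y := x + h • unitVec a with hy
  set i := cellIndex ε x with hi
  set j := cellIndex ε y with hj
  have hxi := (mem_cell_iff hε i x).2 rfl
  have hyj := (mem_cell_iff hε j y).2 rfl
  have hya : y a = x a + h := by simp [hy]
  have hyb : ∀ b, b ≠ a → y b = x b := fun b hb => by simp [hy, hb]
  have hci : cell ε i ⊆ Ω := cell_subset_of_mem_inset hε (by linarith) hx
  have hcj : cell ε j ⊆ Ω := cell_subset_of_mem_inset (r := r - h) hε (by linarith)
    (mem_inset_of_dist_le hh (by linarith) hx (dist_add_smul_unitVec hh a x).le)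
  have hij : i a ≤ j a := by
    simp only [hi, hj, cellIndex, hya]
    gcongr
    linarith
  obtain ⟨k, hk⟩ := Int.le.dest hij
  -- The indices of the squares met by the segment.
  let s : ℕ → Site := fun m => Function.update i a (i a + m)
  have hs0 : s 0 = i := by simp [s]
  have hsk : s k = j := by
    ext b
    by_cases hb : b = a
    · subst hb; simp [s, hk]
    · simp [s, hb, hi, hj, cellIndex, hyb b hb]
  have hsucc : ∀ m, s (m + 1) = s m + Pi.single a 1 := fun m => by
    ext b
    by_cases hb : b = a
    · subst hb; simp [s, add_assoc]
    · simp [s, hb]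
  have hmk : ∀ m ≤ k, ε * ((i a : ℝ) + m) ≤ ε * (j a : ℝ) := fun m hm => by
    rw [← hk]
    push_cast
    gcongr
  -- Only the centres of the intermediate squares need to lie in `Ω`.
  have hmem : ∀ m ≤ k, s m ∈ scaledSites Ω ε := fun m hm => by
    refine mem_of_mem_inset_of_dist_le hx ((dist_le_sum_abs _ _).trans ?_)
    have ha : |x a - (ε • (s m).toPlane) a| ≤ ε + h := by
      have h1 := hmk m hm
      have h2 : 0 ≤ ε * m := by positivity
      have e : (ε • (s m).toPlane) a = ε * ((i a : ℝ) + m) := by simp [s, Site.toPlane]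
      have h3 := hxi a
      have h4 := hyj a
      rw [e, mul_add] at *
      exact abs_le.2 ⟨by linarith, by linarith⟩
    have hb : ∀ b, b ≠ a → |x b - (ε • (s m).toPlane) b| ≤ ε := fun b hb => by
      have e : (ε • (s m).toPlane) b = ε * (i b : ℝ) := by simp [s, Site.toPlane, hb]
      have h3 := hxi b
      rw [e]
      exact abs_le.2 ⟨by linarith, by linarith⟩
    rw [Fin.sum_univ_two]
    fin_cases a
    · have ha' : |x 0 - (ε • (s m).toPlane) 0| ≤ ε + h := ha
      linarith [hb 1 (by simp)]
    · have ha' : |x 1 - (ε • (s m).toPlane) 1| ≤ ε + h := ha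
      linarith [hb 0 (by simp)]
  let w : ℕ → ℝ := fun m => if hm : s m ∈ scaledSites Ω ε then spinVal (u ⟨s m, hm⟩) else 0
  have hwx : extension u x = w 0 := by
    rw [extension_of_mem_cell hε u hci hxi]
    simp only [w, hs0, dif_pos (mem_scaledSites_of_cell_subset hε hci)]
  have hwy : extension u y = w k := by
    rw [extension_of_mem_cell hε u hcj hyj]
    simp only [w, hsk, dif_pos (mem_scaledSites_of_cell_subset hε hcj)]
  have hinj : Function.Injective s := fun m m' hmm' => by
    have := congrFun hmm' a
    simpa [s] using this
  rw [hwx, hwy, ← edist_eq_enorm_sub, edist_comm]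
  calc edist (w 0) (w k) ≤ ∑ m ∈ Finset.range k, edist (w m) (w (m + 1)) :=
        edist_le_range_sum_edist w k
    _ = ∑ m ∈ Finset.range k, (crossing ε h a (s m)).indicator (fun _ => jump u a (s m)) x := by
        refine Finset.sum_congr rfl fun m hm => ?_
        have hm' := Finset.mem_range.1 hm
        have hcross : x ∈ crossing ε h a (s m) := fun b => by
          by_cases hb : b = a
          · subst hb
            have h1 := hmk (m + 1) hm'
            have h2 : 0 ≤ ε * m := by positivity
            have h3 := hxi b
            have h4 := hyj b
            push_cast at h1
            simp only [s, Function.update_self, Int.cast_add, Int.cast_natCast]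
            constructor <;> linarith
          · simpa [s, hb] using hxi b
        have h0 := hmem m hm'.le
        have h1 := hmem (m + 1) hm'
        rw [indicator_of_mem hcross, edist_comm, edist_eq_enorm_sub, jump,
          dif_pos ⟨h0, hsucc m ▸ h1⟩]
        simp only [w, dif_pos h0, dif_pos h1, hsucc m]
    _ ≤ ∑' m, (crossing ε h a (s m)).indicator (fun _ => jump u a (s m)) x :=
        ENNReal.sum_le_tsum _
    _ ≤ ∑' i, (crossing ε h a i).indicator (fun _ => jump u a i) x :=
        ENNReal.tsum_comp_le_tsum_of_injective hinj
          fun i => (crossing ε h a i).indicator (fun _ => jump u a i) x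

theorem hasTranslationBound_extension {S : Type*} (ξ : Bond → S → ℝ) (ω : S) {Ω : Set Plane}
    {ε r : ℝ} (hε : 0 < ε) (hr : 4 * ε ≤ r) (u : SpinFun Ω ε) :
    HasTranslationBound Ω (4 * energy ξ ω Ω ε u) (extension u) r := by
  intro a h hh hhr
  calc ∫⁻ x in inset Ω r, ‖extension u (x + h • unitVec a) - extension u x‖ₑ
      ≤ ∫⁻ x in inset Ω r, ∑' i, (crossing ε h a i).indicator (fun _ => jump u a i) x :=
        setLIntegral_mono' (measurableSet_inset _ _) fun x hx =>
          enorm_extension_sub_le hε hr hh hhr u a hx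
    _ ≤ ∫⁻ x, ∑' i, (crossing ε h a i).indicator (fun _ => jump u a i) x :=
        setLIntegral_le_lintegral _ _
    _ = ∑' i, jump u a i * (ENNReal.ofReal ε * ENNReal.ofReal h) := by
        rw [lintegral_tsum fun i =>
          (measurable_const.indicator (measurableSet_crossing ε h a i)).aemeasurable]
        refine tsum_congr fun i => ?_
        rw [lintegral_indicator_const (measurableSet_crossing ε h a i), volume_crossing]
    _ = (∑' i, jump u a i) * ENNReal.ofReal ε * ENNReal.ofReal h := by
        rw [ENNReal.tsum_mul_right, mul_assoc]
    _ ≤ 4 * energy ξ ω Ω ε u * ENNReal.ofReal h :=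
        mul_le_mul_left (tsum_jump_le_energy ξ ω u a) _

theorem HasTranslationBound.mono {Ω : Set Plane} {C C' : ℝ≥0∞} {f : Plane → ℝ} {r : ℝ}
    (hf : HasTranslationBound Ω C f r) (hC : C ≤ C') : HasTranslationBound Ω C' f r :=
  fun a h hh hr => (hf a h hh hr).trans (by gcongr)

/-- Equi-coerciveness of the spin energies, for each fixed configuration of the bonds. -/
theorem exists_memBVSpin_tendsto {S : Type*} (ξ : Bond → S → ℝ) (ω : S) {Ω : Set Plane}
    (hΩ : IsOpen Ω) (hΩb : Bornology.IsBounded Ω) {ε : ℕ → ℝ} (hε : ∀ k, 0 < ε k)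
    (hε0 : Tendsto ε atTop (𝓝 0)) (u : (k : ℕ) → SpinFun Ω (ε k))
    (hE : (⨆ k, energy ξ ω Ω (ε k) (u k)) < ∞) :
    ∃ v : Plane → ℝ, MemBVSpin Ω v ∧ ∃ n : ℕ → ℕ, StrictMono n ∧
      Tendsto (fun m => eLpNorm (fun x => extension (u (n m)) x - v x) 1
        (volume.restrict Ω)) atTop (𝓝 0) := by
  set C : ℝ≥0∞ := 4 * ⨆ k, energy ξ ω Ω (ε k) (u k) with hCdef
  have hC : C ≠ ∞ := ENNReal.mul_ne_top (by simp) hE.ne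
  have hm : ∀ k, Measurable (extension (u k)) := fun k => measurable_extension _
  have h1 : ∀ k x, |extension (u k) x| ≤ 1 := fun k x => by
    rcases extension_eq_or (u k) x with h | h <;> simp [h]
  have hbound : ∀ r > 0, ∀ᶠ k in atTop, HasTranslationBound Ω C (extension (u k)) r := by
    intro r hr
    filter_upwards [hε0.eventually_lt_const (show 0 < r / 4 by positivity)] with k hk
    refine (hasTranslationBound_extension ξ ω (hε k) (by linarith) (u k)).mono ?_
    rw [hCdef]
    gcongr
    exact le_iSup (fun k => energy ξ ω Ω (ε k) (u k)) k
  obtain ⟨v, hv, n, hn, hlim⟩ := exists_subseq_tendsto_eLpNorm hΩ hΩb hC hm h1 hbound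
  -- A pointwise convergent subsequence shows that the limit takes the values `±1` almost everywhere.
  have hv_ae : ∀ᵐ x ∂volume.restrict Ω, v x = 1 ∨ v x = -1 := by
    obtain ⟨l, -, hl⟩ := (tendstoInMeasure_of_tendsto_eLpNorm one_ne_zero
      (fun m => (hm (n m)).aestronglyMeasurable) hv.aestronglyMeasurable hlim).exists_seq_tendsto_ae
    filter_upwards [hl] with x hx
    have hcl : IsClosed ({1, -1} : Set ℝ) := (Set.toFinite _).isClosed
    exact hcl.mem_of_tendsto hx (.of_forall fun m => extension_eq_or _ x)
  let v' : Plane → ℝ := fun x => if v x = 1 then 1 else -1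
  have hv' : Measurable v' :=
    Measurable.ite (hv (measurableSet_singleton 1)) measurable_const measurable_const
  have hv'_or : ∀ x, v' x = 1 ∨ v' x = -1 := fun x => by
    by_cases h : v x = 1 <;> simp [v', h]
  have hvv' : v =ᵐ[volume.restrict Ω] v' := by
    filter_upwards [hv_ae] with x hx
    rcases hx with h | h
    · simp [v', h]
    · simp only [v', h]; norm_num
  have hlim' : Tendsto (fun m => eLpNorm (extension (u (n m)) - v') 1 (volume.restrict Ω))
      atTop (𝓝 0) := by
    refine hlim.congr fun m => eLpNorm_congr_ae ?_
    filter_upwards [hvv'] with x hx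
    simp [hx]
  refine ⟨v', ⟨?_, fun x _ => hv'_or x⟩, n, hn, hlim'⟩
  refine MemBV.of_hasTranslationBound hΩ hΩb hC hv' (fun x => ?_) fun r hr => ?_
  · rcases hv'_or x with h | h <;> simp [h]
  · exact HasTranslationBound.of_tendsto hΩ (fun m => hm (n m)) hv'
      (hn.tendsto_atTop.eventually (hbound r hr)) hlim'

end RigidSpin

end

theorem lemma5p1 {S : Type*} [MeasurableSpace S] (P : Measure S) [IsProbabilityMeasure P]
    (p : ℝ) (hp : p ∈ Icc (0 : ℝ) 1) (ξ : RigidSpin.Bond → S → ℝ)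
    (hξ : RigidSpin.IsBondPercolation P ξ p)
    (Ω : Set RigidSpin.Plane) (hΩb : Bornology.IsBounded Ω) (hΩ : RigidSpin.IsLipschitzOpen Ω) :
    ∀ᵐ ω ∂P, ∀ ε : ℕ → ℝ, (∀ k, 0 < ε k) → Tendsto ε atTop (𝓝 0) →
      ∀ u : (k : ℕ) → RigidSpin.SpinFun Ω (ε k),
        (⨆ k, RigidSpin.energy ξ ω Ω (ε k) (u k)) < ∞ →
        ∃ v : RigidSpin.Plane → ℝ, RigidSpin.MemBVSpin Ω v ∧
          ∃ n : ℕ → ℕ, StrictMono n ∧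
            Tendsto (fun m => eLpNorm (fun x => RigidSpin.extension (u (n m)) x - v x) 1
              (volume.restrict Ω)) atTop (𝓝 0) := by
  exact .of_forall fun ω _ hε hε0 u hE =>
    RigidSpin.exists_memBVSpin_tendsto ξ ω hΩ.1 hΩb hε hε0 u hE
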